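/- Let $(X_t)_{t\ge 0}$ be a real-valued process with $X_0=0$ such that $(e^{X_t})_{t\ge 0}$ is a martingale. For $t>0$ and $\kappa\in\mathbb R$ set $c(\kappa,t)=E[(e^{X_t}-e^{\kappa})^+]$ and $p(\kappa,t)=E[(e^{\kappa}-e^{X_t})^+]$, and let the implied volatility $\sigma_{\rm imp}(\kappa,t)$ be the unique $\sigma\in[0,\infty)$ with $C_{BS}(\kappa,\sigma\sqrt t)=c(\kappa,t)$, where $C_{BS}(\kappa,v)=E[(e^{vZ-v^2/2}-e^{\kappa})^+]$ and $Z$ is a standard Gaussian random variable. Let $\phi$ and $\Phi$ be the density and the distribution function of $Z$, let $D(z)=\phi(z)/z-\Phi(-z)$ for $z>0$, which is a strictly decreasing bijection of $(0,\infty)$ onto itself, and let $D^{-1}$ be its inverse. Write $f\sim g$ for $f/g\to1$, and $x^+=\max(x,0)$, $x^-=\max(-x,0)$. Assume that there is a function $(\gamma_t)_{t>0}$ with $\gamma_t>0$ and $\gamma_t\to0$ as $t\downarrow0$ such that $X_t/\gamma_t$ converges in law to a random variable $Y$ as $t\downarrow 0$, and that for some $\eta>0$ $$\limsup_{t\downarrow0}E\left[\left|\frac{e^{X_t}-1}{\gamma_t}\right|^{1+\eta}\right]<\infty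 .$$ Then $Y$ is integrable and $E[Y]=0$. Moreover, let $a\in[0,\infty)$ and consider any family of values of $(\kappa,t)$ with $\kappa\ge0$, $t>0$, along which $t\to0$ and $\kappa/\gamma_t\to a$. (i) If $P(Y>a)>0$, then along this family $$c(\kappa,t)\sim\gamma_t\,E[(Y-a)^+],\qquad \sigma_{\rm imp}(\kappa,t)\sim C_+(a)\,\frac{\gamma_t}{\sqrt t}.$$ (ii) If $P(Y<-a)>0$, then along this family $$p(-\kappa,t)\sim\gamma_t\,E[(Y+a)^-],\qquad \sigma_{\rm imp}(-\kappa,t)\sim C_-(a)\,\frac{\gamma_t}{\sqrt t}.$$ Here $$C_+(a)=\frac{a}{D^{-1}\big(E[(Y-a)^+]/a\big)},\qquad C_-(a)=\frac{a}{D^{-1}\big(E[(Y+a)^-]/a\big)}\qquad\text{if } a>0,$$ and $C_\pm(0)=\sqrt{2\pi}\,E[Y^\pm]$. -/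

import Mathlib

open MeasureTheory ProbabilityTheory Filter Topology
open scoped NNReal ENNReal Asymptotics

noncomputable section

namespace TypicalDeviations

/-- Price of the European call with log-strike `κ` when the log-price at maturity is `X`:
`E[(e^X - e^κ)⁺]`. -/
def callPrice {Ω : Type*} [MeasurableSpace Ω] (P : Measure Ω) (X : Ω → ℝ) (κ : ℝ) : ℝ :=
  ∫ ω, (Real.exp (X ω) - Real.exp κ)⁺ ∂P

/-- Price of the European put with log-strike `κ`: `E[(e^κ - e^X)⁺]`. -/
def putPrice {Ω : Type*} [MeasurableSpace Ω] (P : Measure Ω) (X : Ω → ℝ) (κ : ℝ) : ℝ :=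
  ∫ ω, (Real.exp κ - Real.exp (X ω))⁺ ∂P

/-- Black–Scholes price of the call with log-strike `κ` and total volatility `v = σ √t`:
`E[(e^{vZ - v²/2} - e^κ)⁺]` with `Z` standard Gaussian. -/
def bsCall (κ v : ℝ) : ℝ :=
  ∫ z, (Real.exp (v * z - v ^ 2 / 2) - Real.exp κ)⁺ ∂(gaussianReal 0 1)

/-- Inverse of the (strictly increasing) function `v ↦ bsCall κ v` on `[0, ∞)`. -/
def bsVol (κ c : ℝ) : ℝ :=
  Function.invFunOn (bsCall κ) (Set.Ici 0) c

/-- Implied volatility at log-strike `κ` and maturity `t` of a model with log-price `X` at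
time `t`: the `σ ≥ 0` with `bsCall κ (σ √t) = callPrice P X κ`. -/
def impliedVol {Ω : Type*} [MeasurableSpace Ω] (P : Measure Ω) (X : Ω → ℝ) (κ t : ℝ) : ℝ :=
  bsVol κ (callPrice P X κ) / √t

/-- `D(z) = φ(z)/z - Φ(-z)`, with `φ` and `Φ` the standard Gaussian density and distribution
function. -/
def D (z : ℝ) : ℝ :=
  gaussianPDFReal 0 1 z / z - cdf (gaussianReal 0 1) (-z)

/-- Inverse of the (strictly decreasing) bijection `D : (0, ∞) → (0, ∞)`. -/
def Dinv (y : ℝ) : ℝ :=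
  Function.invFunOn D (Set.Ioi 0) y

/-- The constant `C₊(a)`, for the random variable `Y`. -/
def Cplus {Ω : Type*} [MeasurableSpace Ω] (P : Measure Ω) (Y : Ω → ℝ) (a : ℝ) : ℝ :=
  if a = 0 then √(2 * Real.pi) * ∫ ω, (Y ω)⁺ ∂P
  else a / Dinv ((∫ ω, (Y ω - a)⁺ ∂P) / a)

/-- The constant `C₋(a)`, for the random variable `Y`. -/
def Cminus {Ω : Type*} [MeasurableSpace Ω] (P : Measure Ω) (Y : Ω → ℝ) (a : ℝ) : ℝ :=
  if a = 0 then √(2 * Real.pi) * ∫ ω, (Y ω)⁻ ∂P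
  else a / Dinv ((∫ ω, (Y ω + a)⁻ ∂P) / a)

end TypicalDeviations

end

/-! Let W = (e^X - 1)/γ. Since e^x - 1 = x(1 + o(1)) at 0, W has the same limit in law as X/γ, and
the moment bound makes W uniformly integrable, so E f(W) → E f(Y) for continuous f with |f(x)| ≤ |x|
(`tendsto_integral_comp_exp_sub_one_div`). The identity gives E[Y] = 0 by the martingale property;
(x - a)⁺ and (-a - x)⁺ give the prices, because the scaled strike (e^κ - 1)/γ tends to its limit and
the positive part is 1-Lipschitz.

The same argument in the Black–Scholes model with total volatility γw, where Y becomes wZ, gives the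
Bachelier price w E[(Z - a/w)⁺] as scaled limit. This is strictly increasing in w, and C₊(a), C₋(a)
are the volatilities at which it equals E[(Y - a)⁺], E[(Y + a)⁻]. Comparing prices at volatilities
γw on either side of γC traps the implied volatility (`tendsto_bsVol_div`); put-call parity reduces
puts to calls. -/

namespace TypicalDeviations

/-! ### Truncation error under a moment of order 1 + η. -/

section Moments

variable {Ω : Type*} [MeasurableSpace Ω] {μ : Measure Ω} [IsProbabilityMeasure μ]

/-- Clipping changes nothing where |x| ≤ M; elsewhere the error is at most |x|, and (|x|/M)^η ≥ 1.
-/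
lemma abs_sub_clip_le {η M : ℝ} (hη : 0 < η) (hM : 0 < M) (x : ℝ) :
    |x - max (-M) (min x M)| ≤ |x| ^ (1 + η) / M ^ η := by
  have hMη : 0 < M ^ η := Real.rpow_pos_of_pos hM η
  by_cases hx : |x| ≤ M
  · obtain ⟨h1, h2⟩ := abs_le.1 hx
    rw [min_eq_left h2, max_eq_right h1, sub_self, abs_zero]
    positivity
  · push Not at hx
    have hx0 : 0 < |x| := hM.trans hx
    have h1 : |x - max (-M) (min x M)| ≤ |x| := by
      rcases lt_abs.1 hx with h | h
      · rw [min_eq_right h.le, max_eq_right (by linarith), abs_of_pos (by linarith)]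
        linarith [le_abs_self x]
      · rw [min_eq_left (by linarith), max_eq_left (by linarith), abs_of_neg (by linarith)]
        linarith [neg_le_abs x]
    refine h1.trans ?_
    rw [le_div_iff₀ hMη, Real.rpow_add hx0, Real.rpow_one]
    gcongr

lemma abs_clip_le {M : ℝ} (hM : 0 < M) (x : ℝ) : |max (-M) (min x M)| ≤ M :=
  abs_le.2 ⟨le_max_left _ _, max_le (by linarith) (min_le_right _ _)⟩

/-- Truncation as a bounded continuous function. -/
noncomputable def clip (M : ℝ) (hM : 0 < M) : BoundedContinuousFunction ℝ ℝ :=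
  BoundedContinuousFunction.ofNormedAddCommGroup (fun x => max (-M) (min x M)) (by fun_prop) M
    (fun x => by simpa using abs_clip_le hM x)

lemma integrable_and_abs_integral_sub_clip_le {W : Ω → ℝ} (hW : AEMeasurable W μ) {η : ℝ}
    (hη : 0 < η) {K : ℝ≥0} (hK : ∫⁻ ω, ENNReal.ofReal (|W ω| ^ (1 + η)) ∂μ ≤ K) {M : ℝ}
    (hM : 0 < M) :
    Integrable W μ ∧ |∫ ω, W ω ∂μ - ∫ ω, max (-M) (min (W ω) M) ∂μ| ≤ K / M ^ η := by
  have hmeas : AEMeasurable (fun ω => |W ω| ^ (1 + η)) μ := by fun_prop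
  have hnn : ∀ ω, 0 ≤ |W ω| ^ (1 + η) := fun ω => by positivity
  have hpow : Integrable (fun ω => |W ω| ^ (1 + η)) μ :=
    (lintegral_ofReal_ne_top_iff_integrable hmeas.aestronglyMeasurable (ae_of_all _ hnn)).1
      (hK.trans_lt ENNReal.coe_lt_top).ne
  have hpowK : ∫ ω, |W ω| ^ (1 + η) ∂μ ≤ K := by
    rw [integral_eq_lintegral_of_nonneg_ae (ae_of_all _ hnn) hmeas.aestronglyMeasurable]
    exact ENNReal.toReal_le_coe_of_le_coe hK
  have hclip : Integrable (fun ω => max (-M) (min (W ω) M)) μ :=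
    Integrable.of_bound (by fun_prop) M (ae_of_all _ fun ω => by simpa using abs_clip_le hM _)
  have hdiff : Integrable (fun ω => W ω - max (-M) (min (W ω) M)) μ :=
    (hpow.div_const (M ^ η)).mono' (by fun_prop)
      (ae_of_all _ fun ω => by simpa using abs_sub_clip_le hη hM _)
  have hint : Integrable W μ := by
    simpa only [Pi.add_def, sub_add_cancel] using hdiff.add hclip
  refine ⟨hint, ?_⟩
  rw [← integral_sub hint hclip]
  calc |∫ ω, (W ω - max (-M) (min (W ω) M)) ∂μ|
      ≤ ∫ ω, |W ω - max (-M) (min (W ω) M)| ∂μ := abs_integral_le_integral_abs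
    _ ≤ ∫ ω, |W ω| ^ (1 + η) / M ^ η ∂μ :=
        integral_mono hdiff.abs (hpow.div_const _) fun ω => abs_sub_clip_le hη hM _
    _ ≤ K / M ^ η := by
        rw [integral_div]
        gcongr

end Moments

/-! ### Convergence of means from convergence in law. -/

section Distribution

variable {T : Type*} {l : Filter T} {Ω Ω' : Type*} [MeasurableSpace Ω] [MeasurableSpace Ω']
  {P : Measure Ω} [IsProbabilityMeasure P] {P' : Measure Ω'} [IsProbabilityMeasure P']
  {W : T → Ω → ℝ} {Y : Ω' → ℝ}

/-- Fatou's lemma for convergence in distribution. -/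
lemma lintegral_le_of_tendstoInDistribution [l.NeBot]
    (h : TendstoInDistribution W l Y (fun _ => P) P') {f : ℝ → ℝ} (hf : Continuous f)
    {K : ℝ≥0} (hK : ∀ᶠ t in l, ∫⁻ ω, ENNReal.ofReal (f (W t ω)) ∂P ≤ K) :
    ∫⁻ ω, ENNReal.ofReal (f (Y ω)) ∂P' ≤ K := by
  have hYm := h.aemeasurable_limit
  -- Cutting f⁺ at height n gives a bounded continuous test function; the cut is removed by monotone
  -- convergence.
  let g : ℕ → BoundedContinuousFunction ℝ ℝ≥0 := fun n =>
    BoundedContinuousFunction.mkOfBound ⟨fun x => min (f x).toNNReal n, by fun_prop⟩ n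
      (fun x y => by
        rw [NNReal.dist_eq, abs_le]
        have h1 : ((min (f x).toNNReal (n : ℝ≥0) : ℝ≥0) : ℝ) ≤ n := by
          exact_mod_cast min_le_right _ _
        have h2 : ((min (f y).toNNReal (n : ℝ≥0) : ℝ≥0) : ℝ) ≤ n := by
          exact_mod_cast min_le_right _ _
        have h3 := NNReal.coe_nonneg (min (f x).toNNReal (n : ℝ≥0))
        have h4 := NNReal.coe_nonneg (min (f y).toNNReal (n : ℝ≥0))
        exact ⟨by simp only [ContinuousMap.coe_mk]; linarith,
          by simp only [ContinuousMap.coe_mk]; linarith⟩)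
  have hg : ∀ n x, (g n x : ℝ≥0∞) = min (ENNReal.ofReal (f x)) n := fun n x => by
    change ((min (f x).toNNReal (n : ℝ≥0) : ℝ≥0) : ℝ≥0∞) = _
    rw [ENNReal.coe_min]; rfl
  have hbd : ∀ n, ∫⁻ ω, (g n (Y ω) : ℝ≥0∞) ∂P' ≤ K := by
    intro n
    have ht := (ProbabilityMeasure.tendsto_iff_forall_lintegral_tendsto.1 h.tendsto) (g n)
    simp only [ProbabilityMeasure.coe_mk] at ht
    rw [lintegral_map' (by fun_prop) hYm] at ht
    refine le_of_tendsto ht ?_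
    filter_upwards [hK] with t ht
    rw [lintegral_map' (by fun_prop) (h.forall_aemeasurable t)]
    refine (lintegral_mono fun ω => ?_).trans ht
    rw [hg]
    exact min_le_left _ _
  have hlim : Tendsto (fun n => ∫⁻ ω, (g n (Y ω) : ℝ≥0∞) ∂P') atTop
      (𝓝 (∫⁻ ω, ENNReal.ofReal (f (Y ω)) ∂P')) := by
    refine lintegral_tendsto_of_tendsto_of_monotone (fun n => by fun_prop) ?_ ?_
    · refine ae_of_all _ fun ω m n hmn => ?_
      simp only [hg]
      gcongr
    · refine ae_of_all _ fun ω => ?_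
      simp only [hg]
      obtain ⟨N, hN⟩ := exists_nat_ge (f (Y ω))
      refine tendsto_const_nhds.congr' ?_
      filter_upwards [eventually_ge_atTop N] with n hn
      rw [min_eq_left]
      rw [← ENNReal.ofReal_natCast]
      exact ENNReal.ofReal_le_ofReal (hN.trans (by exact_mod_cast hn))
  exact le_of_tendsto' hlim hbd

/-- Convergence in distribution together with a bounded moment of order larger than one implies
convergence of the means. -/
lemma tendsto_integral_of_tendstoInDistribution [l.NeBot]
    (h : TendstoInDistribution W l Y (fun _ => P) P') {η : ℝ} (hη : 0 < η) {K : ℝ≥0}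
    (hK : ∀ᶠ t in l, ∫⁻ ω, ENNReal.ofReal (|W t ω| ^ (1 + η)) ∂P ≤ K) :
    Integrable Y P' ∧ Tendsto (fun t => ∫ ω, W t ω ∂P) l (𝓝 (∫ ω, Y ω ∂P')) := by
  -- The limit inherits the moment bound K, so one M controls the truncation error of Y and of every
  -- W t eventually.
  have hYK := lintegral_le_of_tendstoInDistribution h (f := fun x => |x| ^ (1 + η))
    (by fun_prop (disch := linarith)) hK
  have hYm := h.aemeasurable_limit
  refine ⟨(integrable_and_abs_integral_sub_clip_le hYm hη hYK one_pos).1, ?_⟩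
  rw [Metric.tendsto_nhds]
  intro ε hε
  have hsmall : Tendsto (fun M : ℝ => K / M ^ η) atTop (𝓝 0) :=
    tendsto_const_nhds.div_atTop (tendsto_rpow_atTop hη)
  obtain ⟨M, hMε, hM⟩ := ((hsmall.eventually_lt_const (show 0 < ε / 3 by positivity)).and
    (eventually_gt_atTop 0)).exists
  have hclip := (ProbabilityMeasure.tendsto_iff_forall_integral_tendsto.1 h.tendsto) (clip M hM)
  simp only [ProbabilityMeasure.coe_mk] at hclip
  rw [integral_map hYm (by fun_prop)] at hclip
  filter_upwards [hK, (Metric.tendsto_nhds.1 hclip) (ε / 3) (by positivity)] with t ht hct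
  have h1 := (integrable_and_abs_integral_sub_clip_le (h.forall_aemeasurable t) hη ht hM).2
  have h2 := (integrable_and_abs_integral_sub_clip_le hYm hη hYK hM).2
  rw [integral_map (h.forall_aemeasurable t) (by fun_prop)] at hct
  change dist (∫ ω, max (-M) (min (W t ω) M) ∂P) (∫ ω, max (-M) (min (Y ω) M) ∂P') < _ at hct
  rw [Real.dist_eq, abs_lt] at *
  rw [abs_le] at h1 h2
  constructor <;> linarith [h1.1, h1.2, h2.1, h2.2, hct.1, hct.2]

end Distribution

/-! ### Linearisation of e^x - 1 and the scaled return. -/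

lemma exp_sub_one_eq_mul_dslope (x : ℝ) : Real.exp x - 1 = x * dslope Real.exp 0 x := by
  simpa using (sub_smul_dslope Real.exp 0 x).symm

/-- `dslope Real.exp 0` is (e^x - 1)/x extended by 1 at 0; its continuity carries all the
linearisations. -/
lemma continuous_dslope_exp : Continuous (dslope Real.exp 0) := by
  rw [← continuousOn_univ, continuousOn_dslope univ_mem]
  exact ⟨Real.continuous_exp.continuousOn, Real.differentiable_exp 0⟩

lemma dslope_exp_zero : dslope Real.exp 0 0 = 1 := by simp

/-- If `x / g → a` and `g → 0`, then `(e^x - 1) / g → a`. -/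
lemma tendsto_exp_sub_one_div {ι : Type*} {l : Filter ι} {x g : ι → ℝ} {a : ℝ}
    (hg : Tendsto g l (𝓝 0)) (hg0 : ∀ᶠ i in l, 0 < g i)
    (hx : Tendsto (fun i => x i / g i) l (𝓝 a)) :
    Tendsto (fun i => (Real.exp (x i) - 1) / g i) l (𝓝 a) := by
  have hx0 : Tendsto x l (𝓝 0) := by
    have := hx.mul hg
    rw [mul_zero] at this
    refine this.congr' ?_
    filter_upwards [hg0] with i hi
    field_simp
  have h := hx.mul ((continuous_dslope_exp.tendsto 0).comp hx0)
  rw [dslope_exp_zero, mul_one] at h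
  refine h.congr fun i => ?_
  rw [exp_sub_one_eq_mul_dslope, Function.comp]
  ring

section ScaledReturn

variable {Ω Ω' : Type*} [MeasurableSpace Ω] [MeasurableSpace Ω']
  {P : Measure Ω} [IsProbabilityMeasure P] {P' : Measure Ω'} [IsProbabilityMeasure P']

/-- The scaled return `(e^X - 1) / γ` has the same limit in law as `X / γ`. -/
lemma tendstoInDistribution_exp_sub_one_div {T : Type*} {l : Filter T} [l.IsCountablyGenerated]
    {X : T → Ω → ℝ} {γ : T → ℝ} {Y : Ω' → ℝ} (hγ : Tendsto γ l (𝓝 0))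
    (hY : TendstoInDistribution (fun t ω => X t ω / γ t) l Y (fun _ => P) P') :
    TendstoInDistribution (fun t ω => (Real.exp (X t ω) - 1) / γ t) l Y (fun _ => P) P' := by
  have hm : TendstoInMeasure P (fun t (_ : Ω) => γ t) l (fun _ => (0 : ℝ)) := by
    rw [tendstoInMeasure_iff_norm]
    intro ε hε
    refine tendsto_const_nhds.congr' ?_
    filter_upwards [(Metric.tendsto_nhds.1 hγ) ε hε] with t ht
    rw [Real.dist_eq, ← Real.norm_eq_abs] at ht
    simp only [not_le.2 ht, Set.ofPred_false, measure_empty]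
  -- Slutsky: (X/γ, γ) tends in law to (Y, 0), and the map g sends (p, 0) to p.
  have h := hY.continuous_comp_prodMk_of_tendstoInMeasure_const
    (g := fun p : ℝ × ℝ => p.1 * dslope Real.exp 0 (p.1 * p.2))
    (continuous_fst.mul (continuous_dslope_exp.comp (continuous_fst.mul continuous_snd)))
    hm (fun _ => aemeasurable_const)
  refine h.congr (fun t => ae_of_all _ fun ω => ?_) (ae_of_all _ fun ω => by simp)
  rcases eq_or_ne (γ t) 0 with h0 | h0
  · simp [h0]
  · simp only [div_mul_cancel₀ _ h0, exp_sub_one_eq_mul_dslope]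
    ring

/-- Convergence of the expectation of a continuous function of at most linear growth of the
scaled return. -/
lemma tendsto_integral_comp_exp_sub_one_div {T : Type*} {l : Filter T} [l.IsCountablyGenerated]
    [l.NeBot] {X : T → Ω → ℝ} {γ : T → ℝ} {Y : Ω' → ℝ} (hγ : Tendsto γ l (𝓝 0))
    (hY : TendstoInDistribution (fun t ω => X t ω / γ t) l Y (fun _ => P) P')
    {η : ℝ} (hη : 0 < η) {K : ℝ≥0}
    (hK : ∀ᶠ t in l,
      ∫⁻ ω, ENNReal.ofReal (|(Real.exp (X t ω) - 1) / γ t| ^ (1 + η)) ∂P ≤ K)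
    {f : ℝ → ℝ} (hf : Continuous f) (hfle : ∀ x, |f x| ≤ |x|) :
    Integrable (fun ω => f (Y ω)) P' ∧
      Tendsto (fun t => ∫ ω, f ((Real.exp (X t ω) - 1) / γ t) ∂P) l
        (𝓝 (∫ ω, f (Y ω) ∂P')) := by
  refine tendsto_integral_of_tendstoInDistribution
    ((tendstoInDistribution_exp_sub_one_div hγ hY).continuous_comp hf) hη (K := K) ?_
  filter_upwards [hK] with t ht
  refine (lintegral_mono fun ω => ENNReal.ofReal_le_ofReal ?_).trans ht
  exact Real.rpow_le_rpow (abs_nonneg _) (hfle _) (by linarith)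

end ScaledReturn

/-! ### The Bachelier price and the function D. -/

section Gaussian

lemma abs_posPart_sub_posPart_le (x y : ℝ) : |x⁺ - y⁺| ≤ |x - y| := by
  simpa only [posPart_def] using abs_max_sub_max_le_abs x y 0

lemma integrable_gaussianReal_id : Integrable (fun z : ℝ => z) (gaussianReal 0 1) :=
  (memLp_id_gaussianReal 1).integrable (by simp)

/-- The price `E[(Z - b)⁺]` of a call on a standard Gaussian variable. -/
noncomputable def gaussCall (b : ℝ) : ℝ := ∫ z, (z - b)⁺ ∂(gaussianReal 0 1)

lemma integrable_gaussCall (b : ℝ) : Integrable (fun z : ℝ => (z - b)⁺) (gaussianReal 0 1) :=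
  (integrable_gaussianReal_id.sub (integrable_const b)).pos_part

lemma gaussCall_antitone : Antitone gaussCall := fun _ _ h =>
  integral_mono (integrable_gaussCall _) (integrable_gaussCall _) fun _ =>
    posPart_mono (by linarith)

lemma gaussCall_pos (b : ℝ) : 0 < gaussCall b := by
  rw [gaussCall, integral_pos_iff_support_of_nonneg (fun _ => posPart_nonneg _)
    (integrable_gaussCall b)]
  have hs : Function.support (fun z : ℝ => (z - b)⁺) = Set.Ioi b := by
    ext z
    simp [Function.mem_support, posPart_eq_zero]
  rw [hs, pos_iff_ne_zero]
  intro h0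
  have := gaussianReal_absolutelyContinuous' 0 one_ne_zero h0
  simp at this

lemma abs_gaussCall_sub_le (b c : ℝ) : |gaussCall b - gaussCall c| ≤ |b - c| := by
  rw [gaussCall, gaussCall, ← integral_sub (integrable_gaussCall b) (integrable_gaussCall c)]
  have h := norm_integral_le_of_norm_le_const (μ := gaussianReal 0 1)
    (f := fun z : ℝ => (z - b)⁺ - (z - c)⁺) (C := |b - c|) (ae_of_all _ fun z => by
      refine (abs_posPart_sub_posPart_le _ _).trans_eq ?_
      rw [abs_sub_comm b c]; congr 1; ring)
  simpa using h

lemma continuous_gaussCall : Continuous gaussCall :=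
  LipschitzWith.continuous (K := 1) <| LipschitzWith.of_dist_le_mul fun b c => by
    simpa [Real.dist_eq] using abs_gaussCall_sub_le b c

lemma hasDerivAt_neg_gaussianPDFReal (x : ℝ) :
    HasDerivAt (fun x => -gaussianPDFReal 0 1 x) (gaussianPDFReal 0 1 x * x) x := by
  have h : HasDerivAt (fun x : ℝ => -((√(2 * Real.pi * (1 : ℝ≥0)))⁻¹ *
      Real.exp (-(x - 0) ^ 2 / (2 * (1 : ℝ≥0))))) _ x :=
    ((((((hasDerivAt_id x).sub_const 0).pow 2).neg.div_const _).exp).const_mul _).neg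
  convert! h using 1
  simp [gaussianPDFReal]
  ring

lemma tendsto_gaussianPDFReal_atTop : Tendsto (gaussianPDFReal 0 1) atTop (𝓝 0) := by
  have h : Tendsto (fun x : ℝ => (√(2 * Real.pi * (1 : ℝ≥0)))⁻¹ *
      Real.exp (-(x - 0) ^ 2 / (2 * (1 : ℝ≥0)))) atTop (𝓝 ((√(2 * Real.pi * (1 : ℝ≥0)))⁻¹ * 0)) := by
    refine Tendsto.const_mul _ (Real.tendsto_exp_atBot.comp ?_)
    refine Tendsto.atBot_div_const (by simp) (tendsto_neg_atTop_atBot.comp ?_)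
    simp
  rw [mul_zero] at h
  exact h

lemma gaussianReal_real_Ioi (b : ℝ) :
    (gaussianReal 0 1).real (Set.Ioi b) = cdf (gaussianReal 0 1) (-b) := by
  have := nullSingletonClass_gaussianReal (μ := 0) (v := 1) one_ne_zero
  rw [cdf_eq_real]
  have h : gaussianReal 0 1 = (gaussianReal 0 1).map (fun x => -x) := by
    rw [gaussianReal_map_neg, neg_zero]
  rw [h, map_measureReal_apply measurable_neg measurableSet_Iic, ← h,
    measureReal_congr Ioi_ae_eq_Ici]
  congr 1
  ext z
  simp

/-- Closed form for the price of a call on a standard Gaussian variable. -/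
lemma gaussCall_eq {b : ℝ} (hb : 0 ≤ b) :
    gaussCall b = gaussianPDFReal 0 1 b - b * cdf (gaussianReal 0 1) (-b) := by
  have hI : ∫ z in Set.Ioi b, z ∂(gaussianReal 0 1) = gaussianPDFReal 0 1 b := by
    rw [← integral_indicator measurableSet_Ioi,
      integral_gaussianReal_eq_integral_smul one_ne_zero]
    have h1 : (fun x => gaussianPDFReal 0 1 x • (Set.Ioi b).indicator (fun z => z) x) =
        (Set.Ioi b).indicator (fun x => gaussianPDFReal 0 1 x * x) := by
      ext x
      by_cases hx : x ∈ Set.Ioi b <;> simp [hx]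
    rw [h1, integral_indicator measurableSet_Ioi,
      integral_Ioi_of_hasDerivAt_of_nonneg' (l := -0)
        (fun x _ => hasDerivAt_neg_gaussianPDFReal x)
        (fun x hx => mul_nonneg (gaussianPDFReal_nonneg _ _ _) (hb.trans (le_of_lt hx)))
        tendsto_gaussianPDFReal_atTop.neg]
    ring
  have h2 : (fun z : ℝ => (z - b)⁺) = (Set.Ioi b).indicator (fun z => z - b) := by
    ext z
    by_cases hz : b < z
    · simp [hz, hz.le]
    · simp [hz, not_lt.1 hz]
  rw [gaussCall, h2, integral_indicator measurableSet_Ioi,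
    integral_sub integrable_gaussianReal_id.integrableOn (integrable_const b), hI,
    setIntegral_const, gaussianReal_real_Ioi, smul_eq_mul, mul_comm]

/-- Hence a D(z) is the Bachelier price at strike a and volatility a/z, which is how D enters the
constants. -/
lemma D_eq {z : ℝ} (hz : 0 < z) : D z = gaussCall z / z := by
  rw [D, gaussCall_eq hz.le]
  field_simp

/-- The function `D` maps `(0, ∞)` onto `(0, ∞)`. -/
lemma surjOn_D : Set.SurjOn D (Set.Ioi 0) (Set.Ioi 0) := by
  intro y hy
  rw [Set.mem_Ioi] at hy
  -- As `gaussCall` decreases, D(z) ≥ `gaussCall 1 / z` on (0, 1] and D(z) ≤ `gaussCall 0 / z` for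
  -- all z > 0; equating these bounds to y gives the bracket.
  set z₁ := min 1 (gaussCall 1 / y) with hz₁
  set z₂ := max 1 (gaussCall 0 / y) with hz₂
  have h1 : 0 < z₁ := lt_min one_pos (div_pos (gaussCall_pos 1) hy)
  have h2 : 0 < z₂ := lt_max_of_lt_left one_pos
  have h12 : z₁ ≤ z₂ := (min_le_left _ _).trans (le_max_left _ _)
  have hc : ContinuousOn D (Set.Icc z₁ z₂) := by
    refine ContinuousOn.congr (f := fun z => gaussCall z / z) ?_
      (fun z hz => D_eq (h1.trans_le hz.1))
    exact continuous_gaussCall.continuousOn.div continuousOn_id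
      (fun z hz => (h1.trans_le hz.1).ne')
  have hy1 : y ≤ D z₁ := by
    rw [D_eq h1, le_div_iff₀ h1]
    calc y * z₁ ≤ y * (gaussCall 1 / y) := by gcongr; exact min_le_right _ _
      _ = gaussCall 1 := by field_simp
      _ ≤ gaussCall z₁ := gaussCall_antitone (min_le_left _ _)
  have hy2 : D z₂ ≤ y := by
    rw [D_eq h2, div_le_iff₀ h2]
    calc gaussCall z₂ ≤ gaussCall 0 := gaussCall_antitone h2.le
      _ = y * (gaussCall 0 / y) := by field_simp
      _ ≤ y * z₂ := by gcongr; exact le_max_right _ _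
  obtain ⟨z, hz, hzy⟩ := intermediate_value_Icc' h12 hc ⟨hy2, hy1⟩
  exact ⟨z, h1.trans_le hz.1, hzy⟩

lemma Dinv_pos {y : ℝ} (hy : 0 < y) : 0 < Dinv y := Function.invFunOn_mem (surjOn_D hy)

/-- Surjectivity is enough: any preimage under D yields a volatility with the required Bachelier
price, and such a volatility is unique by `strictMonoOn_bachelier`. -/
lemma D_Dinv {y : ℝ} (hy : 0 < y) : D (Dinv y) = y := Function.invFunOn_eq (surjOn_D hy)

lemma integral_mul_sub_posPart {w : ℝ} (hw : 0 < w) (a : ℝ) :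
    ∫ z, (w * z - a)⁺ ∂(gaussianReal 0 1) = w * gaussCall (a / w) := by
  rw [gaussCall, ← integral_const_mul]
  congr 1
  ext z
  have h : w * z - a = w * (z - a / w) := by field_simp
  rw [h]
  simp only [posPart_def]
  rw [mul_max_of_nonneg _ _ hw.le, mul_zero]

lemma integral_neg_sub_mul_posPart {w : ℝ} (hw : 0 < w) (a : ℝ) :
    ∫ z, (-a - w * z)⁺ ∂(gaussianReal 0 1) = w * gaussCall (a / w) := by
  rw [← integral_mul_sub_posPart hw]
  have h : gaussianReal 0 1 = (gaussianReal 0 1).map (fun x => -x) := by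
    rw [gaussianReal_map_neg, neg_zero]
  conv_rhs => rw [h, integral_map (by fun_prop) (Continuous.aestronglyMeasurable (by fun_prop))]
  congr 1
  ext z
  congr 1
  ring

/-- The Bachelier price `w E[(Z - a / w)⁺]` is strictly increasing in the volatility `w`. -/
lemma strictMonoOn_bachelier {a : ℝ} (ha : 0 ≤ a) :
    StrictMonoOn (fun w => w * gaussCall (a / w)) (Set.Ioi 0) := by
  intro w₁ h₁ w₂ h₂ h
  rw [Set.mem_Ioi] at h₁ h₂
  calc w₁ * gaussCall (a / w₁) ≤ w₁ * gaussCall (a / w₂) := by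
        gcongr
        exact gaussCall_antitone (by gcongr)
    _ < w₂ * gaussCall (a / w₂) := by
        gcongr
        exact gaussCall_pos _

lemma bachelier_div_Dinv {a m : ℝ} (ha : 0 < a) (hm : 0 < m) :
    0 < a / Dinv (m / a) ∧
      a / Dinv (m / a) * gaussCall (a / (a / Dinv (m / a))) = m := by
  have hy : 0 < m / a := div_pos hm ha
  have hd := Dinv_pos hy
  have h := D_Dinv hy
  rw [D_eq hd] at h
  refine ⟨div_pos ha hd, ?_⟩
  rw [div_div_cancel₀ ha.ne']
  field_simp at h ⊢
  linarith

lemma bachelier_at_the_money {m : ℝ} (hm : 0 < m) :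
    0 < √(2 * Real.pi) * m ∧
      √(2 * Real.pi) * m * gaussCall (0 / (√(2 * Real.pi) * m)) = m := by
  have hpi : 0 < √(2 * Real.pi) := Real.sqrt_pos.2 (by positivity)
  refine ⟨by positivity, ?_⟩
  rw [zero_div, gaussCall_eq le_rfl]
  simp [gaussianPDFReal]
  field_simp

end Gaussian

/-! ### Parity and scaled prices for a general log-price. -/

section Prices

variable {Ω : Type*} [MeasurableSpace Ω] {P : Measure Ω} [IsProbabilityMeasure P]

/-- Put-call parity. -/
lemma callPrice_sub_putPrice {X : Ω → ℝ} (hX : Integrable (fun ω => Real.exp (X ω)) P) (κ : ℝ) :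
    callPrice P X κ - putPrice P X κ = ∫ ω, Real.exp (X ω) ∂P - Real.exp κ := by
  have h1 : Integrable (fun ω => (Real.exp (X ω) - Real.exp κ)⁺) P :=
    (hX.sub (integrable_const _)).pos_part
  have h2 : Integrable (fun ω => (Real.exp κ - Real.exp (X ω))⁺) P :=
    ((integrable_const _).sub hX).pos_part
  have h3 : (Real.exp κ : ℝ) = ∫ _, Real.exp κ ∂P := by simp
  rw [callPrice, putPrice, ← integral_sub h1 h2]
  conv_rhs => rw [h3, ← integral_sub hX (integrable_const _)]
  congr 1
  ext ω
  rw [← neg_sub (Real.exp (X ω)), posPart_neg, posPart_sub_negPart]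

lemma abs_integral_posPart_sub_le {U V : Ω → ℝ} (hU : Integrable U P) (hV : Integrable V P)
    {δ : ℝ} (h : ∀ ω, |U ω - V ω| ≤ δ) :
    |∫ ω, (U ω)⁺ ∂P - ∫ ω, (V ω)⁺ ∂P| ≤ δ := by
  have hU' : Integrable (fun ω => (U ω)⁺) P := hU.pos_part
  have hV' : Integrable (fun ω => (V ω)⁺) P := hV.pos_part
  rw [← integral_sub hU' hV']
  have := norm_integral_le_of_norm_le_const (μ := P)
    (f := fun ω => (U ω)⁺ - (V ω)⁺) (C := δ) (ae_of_all _ fun ω =>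
      (abs_posPart_sub_posPart_le _ _).trans (h ω))
  simpa using this

lemma posPart_div {g : ℝ} (hg : 0 < g) (x : ℝ) : x⁺ / g = (x / g)⁺ := by
  simp only [posPart_def]
  rw [← max_div_div_right hg.le, zero_div]

variable {ι : Type*} {l : Filter ι} {X : ι → Ω → ℝ} {κ g : ι → ℝ} {a m : ℝ}

/-- Replaces the moving strike (e^κ - 1)/g by its limit a, at a cost of at most their distance. It
serves both the model and Black–Scholes. -/
lemma tendsto_callPrice_div (hX : ∀ i, Integrable (fun ω => Real.exp (X i ω)) P)
    (hg : Tendsto g l (𝓝 0)) (hg0 : ∀ᶠ i in l, 0 < g i)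
    (hκ : Tendsto (fun i => κ i / g i) l (𝓝 a))
    (h : Tendsto (fun i => ∫ ω, ((Real.exp (X i ω) - 1) / g i - a)⁺ ∂P) l (𝓝 m)) :
    Tendsto (fun i => callPrice P (X i) (κ i) / g i) l (𝓝 m) := by
  have hb := tendsto_exp_sub_one_div hg hg0 hκ
  have hd : Tendsto (fun i => |(Real.exp (κ i) - 1) / g i - a|) l (𝓝 0) := by
    simpa using (hb.sub_const a).abs
  refine h.congr_dist (squeeze_zero' (Eventually.of_forall fun _ => dist_nonneg) ?_ hd)
  filter_upwards [hg0] with i hi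
  have hW : Integrable (fun ω => (Real.exp (X i ω) - 1) / g i) P :=
    ((hX i).sub (integrable_const 1)).div_const _
  have hc : callPrice P (X i) (κ i) / g i =
      ∫ ω, ((Real.exp (X i ω) - 1) / g i - (Real.exp (κ i) - 1) / g i)⁺ ∂P := by
    rw [callPrice, ← integral_div]
    congr 1
    ext ω
    rw [posPart_div hi]
    congr 1
    ring
  rw [hc, Real.dist_eq]
  refine abs_integral_posPart_sub_le (hW.sub (integrable_const _)) (hW.sub (integrable_const _))
    fun ω => ?_
  simp only [Pi.sub_apply, sub_sub_sub_cancel_left, le_refl]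

lemma tendsto_putPrice_div (hX : ∀ i, Integrable (fun ω => Real.exp (X i ω)) P)
    (hg : Tendsto g l (𝓝 0)) (hg0 : ∀ᶠ i in l, 0 < g i)
    (hκ : Tendsto (fun i => κ i / g i) l (𝓝 a))
    (h : Tendsto (fun i => ∫ ω, (a - (Real.exp (X i ω) - 1) / g i)⁺ ∂P) l (𝓝 m)) :
    Tendsto (fun i => putPrice P (X i) (κ i) / g i) l (𝓝 m) := by
  have hb := tendsto_exp_sub_one_div hg hg0 hκ
  have hd : Tendsto (fun i => |(Real.exp (κ i) - 1) / g i - a|) l (𝓝 0) := by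
    simpa using (hb.sub_const a).abs
  refine h.congr_dist (squeeze_zero' (Eventually.of_forall fun _ => dist_nonneg) ?_ hd)
  filter_upwards [hg0] with i hi
  have hW : Integrable (fun ω => (Real.exp (X i ω) - 1) / g i) P :=
    ((hX i).sub (integrable_const 1)).div_const _
  have hc : putPrice P (X i) (κ i) / g i =
      ∫ ω, ((Real.exp (κ i) - 1) / g i - (Real.exp (X i ω) - 1) / g i)⁺ ∂P := by
    rw [putPrice, ← integral_div]
    congr 1
    ext ω
    rw [posPart_div hi]
    congr 1
    ring
  rw [hc, Real.dist_eq]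
  refine abs_integral_posPart_sub_le ((integrable_const _).sub hW) ((integrable_const _).sub hW)
    fun ω => ?_
  simp only [Pi.sub_apply, sub_sub_sub_cancel_right]
  rw [abs_sub_comm]

end Prices

/-! ### Black–Scholes prices: monotonicity, scaling limit, inversion. -/

section BlackScholes

lemma integrable_exp_gaussianReal (q : ℝ≥0) (v c : ℝ) :
    Integrable (fun z => Real.exp (v * z - c)) (gaussianReal 0 q) := by
  simp only [Real.exp_sub]
  exact (integrable_exp_mul_gaussianReal v).div_const _

lemma integral_exp_gaussianReal (q : ℝ≥0) (v c : ℝ) :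
    ∫ z, Real.exp (v * z - c) ∂(gaussianReal 0 q) = Real.exp (q * v ^ 2 / 2 - c) := by
  simp only [Real.exp_sub]
  rw [integral_div]
  congr 1
  have h := congrFun (mgf_id_gaussianReal (μ := 0) (v := q)) v
  simpa [mgf] using h

lemma bsCall_eq_callPrice (κ v : ℝ) :
    bsCall κ v = callPrice (gaussianReal 0 1) (fun z => v * z - v ^ 2 / 2) κ := rfl

lemma bsCall_eq_integral (κ v : ℝ) :
    bsCall κ v = ∫ x, (Real.exp (1 * x - v ^ 2 / 2) - Real.exp κ)⁺
      ∂(gaussianReal 0 (v ^ 2).toNNReal) := by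
  have h : gaussianReal 0 (v ^ 2).toNNReal = (gaussianReal 0 1).map (fun z => v * z) := by
    rw [gaussianReal_map_const_mul, mul_zero, mul_one]
    congr 1
    ext
    simp [sq_nonneg]
  rw [h, integral_map (by fun_prop) (Continuous.aestronglyMeasurable (by fun_prop))]
  simp only [bsCall, one_mul]

/-- The Black–Scholes price is nondecreasing in the volatility. -/
lemma monotoneOn_bsCall (κ : ℝ) : MonotoneOn (bsCall κ) (Set.Ici 0) := by
  intro v₁ h₁ v₂ h₂ h
  rw [Set.mem_Ici] at h₁ h₂
  have hsq : v₁ ^ 2 ≤ v₂ ^ 2 := by gcongr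
  set q₁ := (v₁ ^ 2).toNNReal with hq₁
  set r := (v₂ ^ 2 - v₁ ^ 2).toNNReal with hr
  have hr' : (r : ℝ) = v₂ ^ 2 - v₁ ^ 2 := Real.coe_toNNReal _ (by linarith)
  -- The larger volatility amounts to adding an independent centred Gaussian of variance r = v₂² -
  -- v₁².
  have hconv : gaussianReal 0 (v₂ ^ 2).toNNReal = gaussianReal 0 q₁ ∗ gaussianReal 0 r := by
    rw [gaussianReal_conv_gaussianReal, add_zero, hq₁, hr,
      ← Real.toNNReal_add (sq_nonneg _) (by linarith), add_sub_cancel]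
  have hint : ∀ (q : ℝ≥0) (c : ℝ),
      Integrable (fun x => (Real.exp (1 * x - c) - Real.exp κ)⁺) (gaussianReal 0 q) := fun q c =>
    ((integrable_exp_gaussianReal q 1 c).sub (integrable_const _)).pos_part
  have hI := hint (v₂ ^ 2).toNNReal (v₂ ^ 2 / 2)
  rw [hconv] at hI
  rw [bsCall_eq_integral, bsCall_eq_integral, hconv, integral_conv hI]
  refine integral_mono (hint _ _) ?_ fun x => ?_
  · have h2 := ((integrable_conv_iff hI.1).1 hI).2
    simpa only [Real.norm_eq_abs, abs_of_nonneg (posPart_nonneg (_ : ℝ))] using h2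
  · have hE : ∀ y, 1 * (x + y) - v₂ ^ 2 / 2 = 1 * y - (v₂ ^ 2 / 2 - x) := fun y => by ring
    simp only [hE]
    have hexp := integrable_exp_gaussianReal r 1 (v₂ ^ 2 / 2 - x)
    -- Jensen for the positive part: integrating out the increment returns e^{x - v₁²/2}.
    refine max_le ?_ (integral_nonneg fun y => posPart_nonneg _)
    calc Real.exp (1 * x - v₁ ^ 2 / 2) - Real.exp κ
        = ∫ y, (Real.exp (1 * y - (v₂ ^ 2 / 2 - x)) - Real.exp κ) ∂(gaussianReal 0 r) := by
          rw [integral_sub hexp (integrable_const _), integral_exp_gaussianReal, hr']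
          simp only [integral_const, probReal_univ, one_smul]
          congr 2
          ring
      _ ≤ _ := integral_mono (hexp.sub (integrable_const _)) (hint _ _) fun y => le_posPart _

lemma exp_mul_le_add {M z x : ℝ} (hx : |x| ≤ M) :
    Real.exp (x * z) ≤ Real.exp (M * z) + Real.exp (-M * z) := by
  have h : x * z ≤ M * |z| := (le_abs_self _).trans (by rw [abs_mul]; gcongr)
  have h1 := Real.exp_pos (M * z)
  have h2 := Real.exp_pos (-M * z)
  rcases abs_cases z with ⟨hz, _⟩ | ⟨hz, _⟩ <;> rw [hz] at h
  · linarith [Real.exp_le_exp.2 h]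
  · rw [mul_neg, ← neg_mul] at h
    linarith [Real.exp_le_exp.2 h]

lemma continuous_bsCall (κ : ℝ) : Continuous (bsCall κ) := by
  rw [continuous_iff_continuousAt]
  intro v₀
  refine continuousAt_of_dominated
    (bound := fun z => Real.exp ((|v₀| + 1) * z) + Real.exp (-(|v₀| + 1) * z))
    (Eventually.of_forall fun v => Continuous.aestronglyMeasurable (by fun_prop)) ?_
    ((integrable_exp_mul_gaussianReal _).add (integrable_exp_mul_gaussianReal _))
    (ae_of_all _ fun z => by fun_prop)
  filter_upwards [Metric.ball_mem_nhds v₀ one_pos] with v hv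
  refine ae_of_all _ fun z => ?_
  have hv' : |v| ≤ |v₀| + 1 := by
    rw [Metric.mem_ball, Real.dist_eq] at hv
    have := abs_sub_abs_le_abs_sub v v₀
    linarith
  rw [Real.norm_eq_abs, abs_of_nonneg (posPart_nonneg _)]
  refine (max_le ?_ (Real.exp_pos (v * z)).le).trans (exp_mul_le_add hv')
  have h1 : Real.exp (v * z - v ^ 2 / 2) ≤ Real.exp (v * z) :=
    Real.exp_le_exp.2 (by linarith [sq_nonneg v])
  linarith [Real.exp_pos κ]

/-- The scaled Black–Scholes return converges to a Gaussian variable, also in mean. -/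
lemma tendsto_integral_gaussian_return {w A : ℝ} (hw : 0 ≤ w) {f : ℝ → ℝ} (hf : Continuous f)
    (hfle : ∀ x, |f x| ≤ |x| + A) :
    Tendsto (fun g : ℝ => ∫ z, f ((Real.exp (g * w * z - (g * w) ^ 2 / 2) - 1) / g)
      ∂(gaussianReal 0 1)) (𝓝[>] 0) (𝓝 (∫ z, f (w * z) ∂(gaussianReal 0 1))) := by
  -- For g < 1 and y = w|z| + w²/2, the exponent x satisfies |x| ≤ gy, so |e^x - 1| ≤ |x|e^{|x|} ≤ g
  -- y e^y ≤ g e^{2y}. The two exponentials in b dominate e^{2w|z|}.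
  set b : ℝ → ℝ := fun z => Real.exp (w ^ 2) * (Real.exp (2 * w * z) + Real.exp (-(2 * w) * z)) + A
  refine tendsto_integral_filter_of_dominated_convergence b
    (Eventually.of_forall fun g => Continuous.aestronglyMeasurable (by fun_prop)) ?_
    ((((integrable_exp_mul_gaussianReal _).add (integrable_exp_mul_gaussianReal _)).const_mul
      _).add (integrable_const A)) (ae_of_all _ fun z => ?_)
  · filter_upwards [Ioo_mem_nhdsGT (show (0 : ℝ) < 1 from one_pos)] with g hg
    refine ae_of_all _ fun z => (hfle _).trans (add_le_add_left ?_ A)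
    have hg0 : 0 < g := hg.1
    set x := g * w * z - (g * w) ^ 2 / 2 with hx
    set y := w * |z| + w ^ 2 / 2 with hy
    have hy0 : 0 ≤ y := by positivity
    have hxy : |x| ≤ g * y := by
      have h1 : |x| ≤ |g * w * z| + |(g * w) ^ 2 / 2| := abs_sub _ _
      rw [abs_mul, abs_of_nonneg (mul_nonneg hg0.le hw),
        abs_of_nonneg (show 0 ≤ (g * w) ^ 2 / 2 by positivity)] at h1
      have h2 : g ^ 2 * w ^ 2 ≤ g * w ^ 2 := by
        gcongr
        nlinarith [hg.2]
      rw [hy]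
      nlinarith
    have hxy' : |x| ≤ y := hxy.trans (by nlinarith [hg.2])
    have hexp : |Real.exp x - 1| ≤ |x| * Real.exp |x| := by
      have h1 := Real.add_one_le_exp x
      have h2 := Real.add_one_le_exp (-x)
      have h3 : Real.exp (-x) * Real.exp x = 1 := by rw [← Real.exp_add]; simp
      have h4 := Real.exp_pos x
      have h5 : Real.exp x ≤ Real.exp |x| := Real.exp_le_exp.2 (le_abs_self x)
      have h6 : (1 : ℝ) ≤ Real.exp |x| := Real.one_le_exp (abs_nonneg x)
      rw [abs_le]
      constructor
      · nlinarith [neg_abs_le x, abs_nonneg x]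
      · have h7 : Real.exp x - 1 ≤ x * Real.exp x := by nlinarith
        refine h7.trans ?_
        gcongr
        exact le_abs_self x
    rw [abs_div, abs_of_pos hg0, div_le_iff₀ hg0]
    have hz : Real.exp (2 * y) ≤
        Real.exp (w ^ 2) * (Real.exp (2 * w * z) + Real.exp (-(2 * w) * z)) := by
      rw [hy, show 2 * (w * |z| + w ^ 2 / 2) = w ^ 2 + 2 * w * |z| by ring, Real.exp_add]
      gcongr
      rcases abs_cases z with ⟨h, _⟩ | ⟨h, _⟩ <;> rw [h]
      · linarith [Real.exp_pos (-(2 * w) * z)]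
      · rw [mul_neg, ← neg_mul]
        linarith [Real.exp_pos (2 * w * z)]
    calc |Real.exp x - 1| ≤ |x| * Real.exp |x| := hexp
      _ ≤ g * y * Real.exp y := by gcongr
      _ ≤ g * Real.exp y * Real.exp y := by
          gcongr
          linarith [Real.add_one_le_exp y]
      _ = Real.exp (2 * y) * g := by rw [two_mul, Real.exp_add y y]; ring
      _ ≤ _ := by gcongr
  · refine (hf.tendsto _).comp (tendsto_exp_sub_one_div
      (tendsto_id.mono_left nhdsWithin_le_nhds) self_mem_nhdsWithin ?_)
    have h : Tendsto (fun g : ℝ => w * z - g * w ^ 2 / 2) (𝓝[>] 0)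
        (𝓝 (w * z - 0 * w ^ 2 / 2)) :=
      (Continuous.tendsto (by fun_prop) 0).mono_left nhdsWithin_le_nhds
    rw [zero_mul, zero_div, sub_zero] at h
    refine h.congr' ?_
    filter_upwards [self_mem_nhdsWithin] with g hg
    have : g ≠ 0 := ne_of_gt hg
    field_simp

variable {ι : Type*} {l : Filter ι} {κ g : ι → ℝ} {a : ℝ}

lemma tendsto_bsCall_div (hg : Tendsto g l (𝓝 0)) (hg0 : ∀ᶠ i in l, 0 < g i)
    (hκ : Tendsto (fun i => κ i / g i) l (𝓝 a)) {w : ℝ} (hw : 0 < w) :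
    Tendsto (fun i => bsCall (κ i) (g i * w) / g i) l (𝓝 (w * gaussCall (a / w))) := by
  simp only [bsCall_eq_callPrice]
  refine tendsto_callPrice_div (fun i => integrable_exp_gaussianReal _ _ _) hg hg0 hκ ?_
  rw [← integral_mul_sub_posPart hw]
  refine (tendsto_integral_gaussian_return hw.le (A := |a|) (f := fun x => (x - a)⁺)
    (by fun_prop) fun x => ?_).comp (tendsto_nhdsWithin_iff.2 ⟨hg, hg0⟩)
  rw [abs_of_nonneg (posPart_nonneg _)]
  exact max_le ((le_abs_self _).trans (abs_sub _ _)) (by positivity)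

/-- The Black–Scholes price process has mean 1, so by parity the subtracted term turns the call into
a put; symmetry of Z gives the same Bachelier limit as for calls. -/
lemma tendsto_bsCall_sub_div (hg : Tendsto g l (𝓝 0)) (hg0 : ∀ᶠ i in l, 0 < g i)
    (hκ : Tendsto (fun i => κ i / g i) l (𝓝 (-a))) {w : ℝ} (hw : 0 < w) :
    Tendsto (fun i => (bsCall (κ i) (g i * w) - (1 - Real.exp (κ i))) / g i) l
      (𝓝 (w * gaussCall (a / w))) := by
  have hput : ∀ i, bsCall (κ i) (g i * w) - (1 - Real.exp (κ i)) =
      putPrice (gaussianReal 0 1) (fun z => g i * w * z - (g i * w) ^ 2 / 2) (κ i) := by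
    intro i
    have h := callPrice_sub_putPrice (integrable_exp_gaussianReal 1 (g i * w) ((g i * w) ^ 2 / 2))
      (κ i)
    rw [integral_exp_gaussianReal] at h
    simp only [NNReal.coe_one, one_mul, sub_self, Real.exp_zero] at h
    rw [bsCall_eq_callPrice]
    linarith
  simp only [hput]
  refine tendsto_putPrice_div (fun i => integrable_exp_gaussianReal _ _ _) hg hg0 hκ ?_
  rw [← integral_neg_sub_mul_posPart hw]
  refine (tendsto_integral_gaussian_return hw.le (A := |a|) (f := fun x => (-a - x)⁺)
    (by fun_prop) fun x => ?_).comp (tendsto_nhdsWithin_iff.2 ⟨hg, hg0⟩)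
  rw [abs_of_nonneg (posPart_nonneg _)]
  refine max_le ((le_abs_self _).trans ((abs_sub _ _).trans_eq ?_)) (by positivity)
  rw [abs_neg, add_comm]

/-- Inversion of the scaled Black–Scholes price: the call prices `c` may be shifted by an arbitrary
family `d`, so that the lemma covers puts as well. -/
lemma tendsto_bsVol_div {c d : ι → ℝ} {G : ℝ → ℝ} (hG : StrictMonoOn G (Set.Ioi 0))
    (hg0 : ∀ᶠ i in l, 0 < g i)
    (hbs : ∀ w, 0 < w →
      Tendsto (fun i => (bsCall (κ i) (g i * w) - d i) / g i) l (𝓝 (G w)))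
    {C : ℝ} (hC : 0 < C) (hc : Tendsto (fun i => (c i - d i) / g i) l (𝓝 (G C))) :
    Tendsto (fun i => bsVol (κ i) (c i) / g i) l (𝓝 C) := by
  have key : ∀ w₁ w₂, 0 < w₁ → w₁ < C → C < w₂ → ∀ᶠ i in l,
      w₁ < bsVol (κ i) (c i) / g i ∧ bsVol (κ i) (c i) / g i < w₂ := by
    intro w₁ w₂ h₁ h₁C hCw₂
    have h₂ : 0 < w₂ := hC.trans hCw₂
    filter_upwards [hg0, (hbs w₁ h₁).eventually_lt hc (hG h₁ hC h₁C),
      hc.eventually_lt (hbs w₂ h₂) (hG hC h₂ hCw₂)] with i hi hlow hup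
    rw [div_lt_div_iff_of_pos_right hi, sub_lt_sub_iff_right] at hlow hup
    -- Existence of the implied volatility comes from the bracket itself. The strict price
    -- inequalities at its ends make weak monotonicity of `bsCall` sufficient for locating any
    -- solution.
    have hex : ∃ v ∈ Set.Ici (0 : ℝ), bsCall (κ i) v = c i := by
      have hle : g i * w₁ ≤ g i * w₂ := by
        gcongr
        exact (h₁C.trans hCw₂).le
      obtain ⟨v, hv, hvc⟩ := intermediate_value_Icc hle (continuous_bsCall (κ i)).continuousOn
        ⟨hlow.le, hup.le⟩
      exact ⟨v, (mul_pos hi h₁).le.trans hv.1, hvc⟩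
    have hmem : bsVol (κ i) (c i) ∈ Set.Ici (0 : ℝ) := Function.invFunOn_mem hex
    have heq : bsCall (κ i) (bsVol (κ i) (c i)) = c i := Function.invFunOn_eq hex
    have hmono := monotoneOn_bsCall (κ i)
    rw [lt_div_iff₀ hi, div_lt_iff₀ hi, mul_comm w₁, mul_comm w₂]
    constructor
    · by_contra! hcon
      exact absurd (hmono hmem (mul_pos hi h₁).le hcon) (by rw [heq]; exact not_le.2 hlow)
    · by_contra! hcon
      exact absurd (hmono (mul_pos hi h₂).le hmem hcon) (by rw [heq]; exact not_le.2 hup)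
  rw [tendsto_order]
  constructor
  · intro w hw
    -- The maximum with C/2 keeps the lower volatility positive even if w ≤ 0.
    filter_upwards [key (max w (C / 2)) (C + 1) (lt_max_of_lt_right (by positivity))
      (max_lt hw (by linarith)) (by linarith)] with i hi
    exact (le_max_left _ _).trans_lt hi.1
  · intro w hw
    filter_upwards [key (C / 2) w (by positivity) (by linarith) hw] with i hi using hi.2

end BlackScholes

/-! ### The limiting constants and the passage to equivalents. -/

section Constants

variable {Ω : Type*} [MeasurableSpace Ω] {P : Measure Ω} {Y : Ω → ℝ} {a : ℝ}

/-- `C₊(a)` is the volatility for which the Bachelier price equals `E[(Y - a)⁺]`. -/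
lemma Cplus_spec (ha : 0 ≤ a) (hm : 0 < ∫ ω, (Y ω - a)⁺ ∂P) :
    0 < Cplus P Y a ∧
      Cplus P Y a * gaussCall (a / Cplus P Y a) = ∫ ω, (Y ω - a)⁺ ∂P := by
  rcases ha.eq_or_lt with rfl | ha
  · simp only [Cplus, if_true, sub_zero] at hm ⊢
    exact bachelier_at_the_money hm
  · rw [Cplus, if_neg ha.ne']
    exact bachelier_div_Dinv ha hm

/-- `C₋(a)` is the volatility for which the Bachelier price equals `E[(Y + a)⁻]`. -/
lemma Cminus_spec (ha : 0 ≤ a) (hm : 0 < ∫ ω, (Y ω + a)⁻ ∂P) :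
    0 < Cminus P Y a ∧
      Cminus P Y a * gaussCall (a / Cminus P Y a) = ∫ ω, (Y ω + a)⁻ ∂P := by
  rcases ha.eq_or_lt with rfl | ha
  · simp only [Cminus, if_true, add_zero] at hm ⊢
    exact bachelier_at_the_money hm
  · rw [Cminus, if_neg ha.ne']
    exact bachelier_div_Dinv ha hm

end Constants

section Equivalents

variable {ι : Type*} {l : Filter ι}

lemma isEquivalent_of_tendsto_div {u g : ι → ℝ} {m : ℝ} (hg : ∀ᶠ i in l, 0 < g i) (hm : m ≠ 0)
    (h : Tendsto (fun i => u i / g i) l (𝓝 m)) : u ~[l] fun i => g i * m := by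
  rw [Asymptotics.isEquivalent_iff_tendsto_one (hg.mono fun i hi => mul_ne_zero hi.ne' hm)]
  have h' := h.div_const m
  rw [div_self hm] at h'
  refine h'.congr fun i => ?_
  rw [Pi.div_apply, div_div]

lemma isEquivalent_impliedVol {Ω : Type*} [MeasurableSpace Ω] {P : Measure Ω} {X : ι → Ω → ℝ}
    {κ g : ι → ℝ} {t : ι → ℝ≥0} {C : ℝ} (ht : ∀ᶠ i in l, 0 < t i) (hg : ∀ᶠ i in l, 0 < g i)
    (hC : 0 < C)
    (h : Tendsto (fun i => bsVol (κ i) (callPrice P (X i) (κ i)) / g i) l (𝓝 C)) :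
    (fun i => impliedVol P (X i) (κ i) (t i)) ~[l] fun i => C * (g i / √(t i)) := by
  have hgt : ∀ᶠ i in l, 0 < g i / √(t i) := by
    filter_upwards [ht, hg] with i hi hgi
    exact div_pos hgi (Real.sqrt_pos.2 (by exact_mod_cast hi))
  simp only [mul_comm C]
  refine isEquivalent_of_tendsto_div hgt hC.ne' (h.congr' ?_)
  filter_upwards [ht] with i hi
  have : (0 : ℝ) < √(t i) := Real.sqrt_pos.2 (by exact_mod_cast hi)
  rw [impliedVol, div_div_div_cancel_right₀ this.ne']

end Equivalents

end TypicalDeviations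

/-! ### The main theorem. -/

theorem theorem2p6
    {Ω : Type*} [MeasurableSpace Ω] (P : Measure Ω) [IsProbabilityMeasure P]
    {Ω' : Type*} [MeasurableSpace Ω'] (P' : Measure Ω') [IsProbabilityMeasure P']
    -- the log-price: `X_0 = 0` and `e^X` is a martingale
    (X : ℝ≥0 → Ω → ℝ) (hX0 : ∀ᵐ ω ∂P, X 0 ω = 0)
    (ℱ : Filtration ℝ≥0 ‹MeasurableSpace Ω›)
    (hX : Martingale (fun t ω => Real.exp (X t ω)) ℱ P)
    -- small time scaling
    (γ : ℝ≥0 → ℝ) (hγ_pos : ∀ t, 0 < t → 0 < γ t) (hγ : Tendsto γ (𝓝[>] 0) (𝓝 0))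
    (Y : Ω' → ℝ)
    (hY : TendstoInDistribution (fun t ω => X t ω / γ t) (𝓝[>] 0) Y (fun _ => P) P')
    -- moment condition
    (hmom : ∃ η : ℝ, 0 < η ∧
      limsup (fun t => ∫⁻ ω, ENNReal.ofReal (|(Real.exp (X t ω) - 1) / γ t| ^ (1 + η)) ∂P)
        (𝓝[>] 0) < ∞) :
    (Integrable Y P' ∧ ∫ ω, Y ω ∂P' = 0) ∧
    ∀ a : ℝ, 0 ≤ a →
      -- any family `(κ, t)` with `κ ≥ 0`, `t → 0` and `κ / γ_t → a`
      ∀ {ι : Type*} (l : Filter ι) (κ : ι → ℝ) (t : ι → ℝ≥0),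
        (∀ᶠ i in l, 0 ≤ κ i) →
        Tendsto t l (𝓝[>] 0) →
        Tendsto (fun i => κ i / γ (t i)) l (𝓝 a) →
        (0 < P' {ω | a < Y ω} →
          (fun i => TypicalDeviations.callPrice P (X (t i)) (κ i)) ~[l]
            (fun i => γ (t i) * ∫ ω, (Y ω - a)⁺ ∂P') ∧
          (fun i => TypicalDeviations.impliedVol P (X (t i)) (κ i) (t i)) ~[l]
            (fun i => TypicalDeviations.Cplus P' Y a * (γ (t i) / √(t i)))) ∧
        (0 < P' {ω | Y ω < -a} →
          (fun i => TypicalDeviations.putPrice P (X (t i)) (-κ i)) ~[l]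
            (fun i => γ (t i) * ∫ ω, (Y ω + a)⁻ ∂P') ∧
          (fun i => TypicalDeviations.impliedVol P (X (t i)) (-κ i) (t i)) ~[l]
            (fun i => TypicalDeviations.Cminus P' Y a * (γ (t i) / √(t i)))) := by
  obtain ⟨η, hη, hlim⟩ := hmom
  obtain ⟨K, hlimK, hKtop⟩ := exists_between hlim
  lift K to ℝ≥0 using hKtop.ne
  have hK := (eventually_lt_of_limsup_lt hlimK).mono fun _ h => h.le
  have hint : ∀ t, Integrable (fun ω => Real.exp (X t ω)) P := fun t => hX.integrable t
  have hmean : ∀ t, ∫ ω, Real.exp (X t ω) ∂P = 1 := by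
    intro t
    have h := hX.setIntegral_eq (zero_le (a := t)) MeasurableSet.univ
    rw [setIntegral_univ, setIntegral_univ] at h
    rw [← h, integral_congr_ae (g := fun _ => (1 : ℝ))]
    · simp
    · filter_upwards [hX0] with ω hω
      simp [hω]
  have hconv : ∀ {f : ℝ → ℝ}, Continuous f → (∀ x, |f x| ≤ |x|) → _ := fun hf hfle =>
    TypicalDeviations.tendsto_integral_comp_exp_sub_one_div hγ hY hη hK hf hfle
  -- The identity as test function: every scaled return has mean 0, so its limit does too.
  have hid := hconv continuous_id fun _ => le_rfl
  have hYint : Integrable Y P' := hid.1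
  refine ⟨⟨hYint, ?_⟩, ?_⟩
  · refine tendsto_nhds_unique hid.2 (tendsto_const_nhds.congr fun t => ?_)
    simp only [id]
    rw [integral_div, integral_sub (hint t) (integrable_const 1), hmean]
    simp
  intro a ha ι l κ t _ ht hκ
  have hg : Tendsto (fun i => γ (t i)) l (𝓝 0) := hγ.comp ht
  have ht0 : ∀ᶠ i in l, 0 < t i := (tendsto_nhdsWithin_iff.1 ht).2
  have hg0 : ∀ᶠ i in l, 0 < γ (t i) := ht0.mono fun i hi => hγ_pos _ hi
  refine ⟨fun hpos => ?_, fun hpos => ?_⟩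
  · have hm : 0 < ∫ ω, (Y ω - a)⁺ ∂P' := by
      refine (integral_pos_iff_support_of_nonneg (fun _ => posPart_nonneg _)
        (hYint.sub (integrable_const a)).pos_part).2 ?_
      convert hpos using 2
      ext ω
      simp [Function.mem_support]
    have hprice := TypicalDeviations.tendsto_callPrice_div (fun i => hint (t i)) hg hg0 hκ
      -- Here a ≥ 0 is what gives (x - a)⁺ ≤ |x|.
      ((hconv (f := fun x => (x - a)⁺) (by fun_prop) fun x => by
        rw [abs_of_nonneg (posPart_nonneg _)]
        exact max_le (by linarith [le_abs_self x]) (abs_nonneg x)).2.comp ht)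
    refine ⟨TypicalDeviations.isEquivalent_of_tendsto_div hg0 hm.ne' hprice, ?_⟩
    obtain ⟨hC, hCm⟩ := TypicalDeviations.Cplus_spec ha hm
    refine TypicalDeviations.isEquivalent_impliedVol ht0 hg0 hC ?_
    refine TypicalDeviations.tendsto_bsVol_div (d := fun _ => 0)
      (TypicalDeviations.strictMonoOn_bachelier ha) hg0 (fun w hw => ?_) hC ?_
    · simpa using TypicalDeviations.tendsto_bsCall_div hg hg0 hκ hw
    · simp only [sub_zero, hCm]
      exact hprice
  · have hneg : ∀ x : ℝ, (x + a)⁻ = (-a - x)⁺ := fun x => by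
      rw [← posPart_neg]
      congr 1
      ring
    have hκ' : Tendsto (fun i => -κ i / γ (t i)) l (𝓝 (-a)) := by
      simpa only [neg_div] using hκ.neg
    have hm : 0 < ∫ ω, (Y ω + a)⁻ ∂P' := by
      refine (integral_pos_iff_support_of_nonneg (fun _ => negPart_nonneg _)
        (hYint.add (integrable_const a)).neg_part).2 ?_
      convert hpos using 2
      ext ω
      simp [Function.mem_support, lt_neg_iff_add_neg]
    have hprice := TypicalDeviations.tendsto_putPrice_div (fun i => hint (t i)) hg hg0 hκ'
      ((hconv (f := fun x => (-a - x)⁺) (by fun_prop) fun x => by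
        rw [abs_of_nonneg (posPart_nonneg _)]
        exact max_le (by linarith [neg_le_abs x]) (abs_nonneg x)).2.comp ht)
    simp only [← hneg] at hprice
    refine ⟨TypicalDeviations.isEquivalent_of_tendsto_div hg0 hm.ne' hprice, ?_⟩
    obtain ⟨hC, hCm⟩ := TypicalDeviations.Cminus_spec ha hm
    refine TypicalDeviations.isEquivalent_impliedVol ht0 hg0 hC ?_
    -- Implied volatility is defined through calls. As e^X has mean 1, this shift is call minus put
    -- at log-strike -κ, in the model and in Black–Scholes alike.
    refine TypicalDeviations.tendsto_bsVol_div (d := fun i => 1 - Real.exp (-κ i))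
      (TypicalDeviations.strictMonoOn_bachelier ha) hg0
      (fun w hw => TypicalDeviations.tendsto_bsCall_sub_div hg hg0 hκ' hw) hC ?_
    rw [hCm]
    refine hprice.congr fun i => ?_
    have h := TypicalDeviations.callPrice_sub_putPrice (hint (t i)) (-κ i)
    rw [hmean] at h
    congr 1
    linarith
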